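/- Two-pile global Fibonacci nim: a position $(a,b;r)$ consists of two piles of $a$ and $b$ stones and a bound $r$. A move removes $s$ stones from one of the piles, where $1\le s\le r$ and $s$ is at most the size of that pile, and the bound becomes $2s$. A player who cannot move loses. $(a,b;r)$ is a $\mathcal P$-position if the player not to move has a winning strategy. Let $F_0=0$, $F_1=F_2=1,\dots$ be the Fibonacci numbers. For $a\ge 0$ let $w_a$ be the infinite Fibonacci word on the letters $F_{a+1},F_a$, i.e. the limit of $S_0=F_{a+1}$, $S_1=F_{a+1}F_a$, $S_n=S_{n-1}S_{n-2}$ (concatenation; letters $F_i$ are regarded as indexed by $i$). For an infinite word $W$ of Fibonacci letters let $W(i)$ be the sum of all letters preceding its $i$-th letter, and let $PS(W)$ be the set of all sums of finite initial segments of $W$, including the empty sum $0$. For $m\ge 0$ let $p=p(m)\ge 0$ be the index with $F_p\le m<F_{p+1}$, and let $x=F_{p+1}-m$. For $r\ge 0$ let $\alpha=\alpha(r,p)$ be the integer with $p+\alpha-1\ge 0$ and $F_{p+\alpha-1}\le r<F_{p+\alpha}$. Words $T^{j}(w_p)$ are defined for $j\ge 0$ by $T^0(w_p)=w_p$ and,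 for a negative integer $\alpha$ with $p+\alpha-1\ge 0$, by obtaining $T^{-\alpha}(w_p)$ from $W=T^{-\alpha-1}(w_p)$ by simultaneously replacing every letter by one of - (T1) $F_i\to F_i$; - (T2) $F_i\to F_{i-1}F_{i-2}$; - (T3) $F_i\to F_{i-2}F_{i-3}F_{i-2}$. The letters of $W$ are $F_{p+\alpha+2}$ (largest), $F_{p+\alpha+1}$ (second largest) and, if $\alpha\le -2$, $F_{p+\alpha}$ (smallest). In general (T3) is applied to the largest letter and (T1) to the other letter(s). The step is special if $F_{p+\alpha}<x\le F_{p+\alpha+1}$, and then: - if $\alpha$ is odd: when the $i$-th letter of $W$ is the largest letter, apply (T2) to it if $W(i)\in PS(w_p)$ and (T3) otherwise; apply (T1) to all other letters; - if $\alpha$ is even: when the $i$-th letter of $W$ is the second largest letter, apply (T2) to it if $W(i)\in PS(w_p)$ and (T1) otherwise; apply (T3) to the largest letter and (T1) to the smallest letter. Set $\sigma_m(\alpha)=PS(w_{p+\alpha-1})$ if $\alpha>1$, $\sigma_m(\alpha)=PS(w_{p+\alpha})$ if $0\le\alpha\le 1$, and $\sigma_m(\alpha)=PS(T^{-\alpha}(w_p))$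 if $\alpha<0$. **Theorem.** For all integers $m,k,r\ge 0$, the position $(m,m+k;r)$ is a $\mathcal P$-position if and only if $k\in\sigma_m(\alpha(r,p(m)))$. -/

import Mathlib

namespace FibNim

/-! ### The game -/

/-- A position of two-pile global Fibonacci nim: the two pile sizes and the maximum number `cap`
of stones that may be removed on the next move. -/
structure Pos where
  left : ℕ
  right : ℕ
  cap : ℕ

/-- A move removes `s` stones from one of the two piles, `1 ≤ s ≤ cap`; afterwards at most `2 * s`
stones may be removed (from either pile). -/
inductive Move : Pos → Pos → Prop
  | fromLeft (a b r s : ℕ) (h1 : 1 ≤ s) (hr : s ≤ r) (ha : s ≤ a) :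
      Move ⟨a, b, r⟩ ⟨a - s, b, 2 * s⟩
  | fromRight (a b r s : ℕ) (h1 : 1 ≤ s) (hr : s ≤ r) (hb : s ≤ b) :
      Move ⟨a, b, r⟩ ⟨a, b - s, 2 * s⟩

mutual
/-- The player to move has a winning strategy (a player unable to move loses). -/
inductive IsN : Pos → Prop
  | intro (G G' : Pos) (hmove : Move G G') (h : IsP G') : IsN G
/-- The player not to move has a winning strategy (a player unable to move loses). -/
inductive IsP : Pos → Prop
  | intro (G : Pos) (h : ∀ G' : Pos, Move G G' → IsN G') : IsP G
end

/-! ### Words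

The letters of all words are Fibonacci numbers `F_i`; the letter `F_i` is represented by its
index `i`. An infinite word is a function from positions `0, 1, 2, …` to letters. -/

/-- The finite words `S_0 = x`, `S_1 = xy`, `S_n = S_{n-1} S_{n-2}`. -/
def fibPrefix (x y : ℕ) : ℕ → List ℕ
  | 0 => [x]
  | 1 => [x, y]
  | n + 2 => fibPrefix x y (n + 1) ++ fibPrefix x y n

/-- The infinite Fibonacci word on the letters `x, y`, the limit of the `S_n`.
`S_n` has more than `n` letters, so the default value is never used. -/
def fibWord (x y : ℕ) (n : ℕ) : ℕ :=
  (fibPrefix x y n).getD n x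

/-- The word `w_a`: the Fibonacci word on the letters `F_{a+1}, F_a`. -/
def sturmWord (a : ℕ) : ℕ → ℕ :=
  fibWord (a + 1) a

/-- The sum of all letters (as numbers) at positions smaller than `n`. -/
def partialSum (w : ℕ → ℕ) (n : ℕ) : ℕ :=
  ∑ i ∈ Finset.range n, Nat.fib (w i)

/-- The set of partial sums of a word, including the empty sum `0`. -/
def PS (w : ℕ → ℕ) : Set ℕ :=
  {k | ∃ n : ℕ, k = partialSum w n}

/-- The infinite concatenation `B 0 ++ B 1 ++ B 2 ++ ⋯` of nonempty blocks. The first `n + 1`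
blocks have more than `n` letters in total, so they determine the letter at position `n`. -/
def concatWord (B : ℕ → List ℕ) (n : ℕ) : ℕ :=
  ((List.range (n + 1)).flatMap B).getD n 0

/-! ### The parameters `p` and `α` -/

/-- `p(m)`: the index with `F_p ≤ m < F_{p+1}`. -/
def pIndex (m : ℕ) : ℕ :=
  Nat.greatestFib m

/-- `α(r, p)`: the integer with `F_{p+α-1} ≤ r < F_{p+α}`. -/
def alphaIndex (r p : ℕ) : ℤ :=
  (Nat.greatestFib r : ℤ) + 1 - (p : ℤ)

theorem eq_greatestFib_iff (n t : ℕ) :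
    t = Nat.greatestFib n ↔ Nat.fib t ≤ n ∧ n < Nat.fib (t + 1) := by
  rw [← Nat.le_greatestFib, ← Nat.greatestFib_lt]
  omega

theorem eq_pIndex_iff (m p : ℕ) :
    p = pIndex m ↔ Nat.fib p ≤ m ∧ m < Nat.fib (p + 1) :=
  eq_greatestFib_iff m p

theorem eq_alphaIndex_iff (r p : ℕ) (α : ℤ) :
    α = alphaIndex r p ↔
      0 ≤ (p : ℤ) + α - 1 ∧
        Nat.fib ((p : ℤ) + α - 1).toNat ≤ r ∧ r < Nat.fib ((p : ℤ) + α).toNat := by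
  unfold alphaIndex
  constructor
  · intro h
    have h1 : ((p : ℤ) + α - 1).toNat = Nat.greatestFib r := by omega
    have h2 : ((p : ℤ) + α).toNat = Nat.greatestFib r + 1 := by omega
    rw [h1, h2]
    exact ⟨by omega, (eq_greatestFib_iff r _).1 rfl⟩
  · rintro ⟨h0, h1, h2⟩
    have h3 : ((p : ℤ) + α).toNat = ((p : ℤ) + α - 1).toNat + 1 := by omega
    rw [h3] at h2
    have := (eq_greatestFib_iff r _).2 ⟨h1, h2⟩
    omega

/-! ### The hybrid words -/

/-- The condition `F_{p+α} < x ≤ F_{p+α+1}` for a special transformation at the step that leads to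
`α = -(j + 1)`, where `p = p(m)` and `x = F_{p+1} - m`. -/
def IsSpecial (m j : ℕ) : Prop :=
  Nat.fib (pIndex m - (j + 1)) < Nat.fib (pIndex m + 1) - m ∧
    Nat.fib (pIndex m + 1) - m ≤ Nat.fib (pIndex m - j)

open Classical in
/-- The block replacing the letter `F_i` of the word `T^j(w_p)` when `T^{j+1}(w_p)` is formed
(so `α = -(j + 1)`). Here `s` is the sum of all letters to the left of this letter.
The letters of `T^j(w_p)` are `F_{p-j+1}` (largest), `F_{p-j}` (second largest) and, if `0 < j`,
`F_{p-j-1}` (smallest).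
* Largest letter: (T3) `F_i → F_{i-2} F_{i-3} F_{i-2}`, except that (T2) `F_i → F_{i-1} F_{i-2}` is
  used in a special step with `α` odd if `s ∈ PS(w_p)`.
* Second largest letter: (T1) `F_i → F_i`, except that (T2) is used in a special step with `α` even
  if `s ∈ PS(w_p)`.
* Smallest letter: (T1). -/
noncomputable def hybridBlock (m j s i : ℕ) : List ℕ :=
  if i = pIndex m - j + 1 then
    if IsSpecial m j ∧ Odd (j + 1) ∧ s ∈ PS (sturmWord (pIndex m)) then
      [i - 1, i - 2]
    else
      [i - 2, i - 3, i - 2]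
  else if i = pIndex m - j then
    if IsSpecial m j ∧ Even (j + 1) ∧ s ∈ PS (sturmWord (pIndex m)) then
      [i - 1, i - 2]
    else
      [i]
  else
    [i]

/-- The word `T^j(w_p)` for the smaller pile size `m`, `p = p(m)`. It is used for `j = -α` with
`0 ≤ p + α - 1`, that is for `j + 1 ≤ p`; then all indices above are honest natural numbers. -/
noncomputable def hybridWord (m : ℕ) : ℕ → ℕ → ℕ
  | 0 => sturmWord (pIndex m)
  | j + 1 => concatWord fun n =>
      hybridBlock m j (partialSum (hybridWord m j) n) (hybridWord m j n)

/-- The set `σ_m(α)`. -/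
noncomputable def sigma (m : ℕ) (α : ℤ) : Set ℕ :=
  if α < 0 then PS (hybridWord m (-α).toNat)
  else if α ≤ 1 then PS (sturmWord ((pIndex m : ℤ) + α).toNat)
  else PS (sturmWord ((pIndex m : ℤ) + α - 1).toNat)

end FibNim

namespace FibNim

/-! ### Zeckendorf representations with large indices -/

-- Everything is read off the Zeckendorf representation of the pile difference `k = u + F_b`, where
-- `F_b` is the smallest part. As in one-pile Fibonacci nim, removing `F_b` from the larger pile is
-- a natural winning try. The smaller pile `m` offers one more: removing `F_{b-1}` from it turns the
-- difference into `u + F_{b+1}`. This leaves `m + F_b` unchanged and raises `b` by one, so as long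
-- as no carry with `u` occurs, its success alternates with `b`. It ends with a carry into `u` or
-- when `m` is too small, and `Raisable` records the resulting parity. Hence `(m, m + k; r)` is a
-- P-position iff `k = 0` or `r < F_t`, with `t = b - 1` in the raisable case and `t = b` otherwise
-- (`isP_iff_safe`).
--
-- For the words, fix `g` with `F_g ≤ r < F_{g+1}`. The gap that follows an element of `safeSet m g`
-- is a function of that element, `hybridNext m g`, so a word whose letters obey this rule has
-- exactly the safe differences as partial sums (`Follows.ps_eq_safeSet`). The Fibonacci word `w_p`
-- obeys the rule at `g = p - 1`, and each step `T` lowers `g` by one (`goodBlock_hybridBlock`).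
-- Lowering `g` normally flips raisability, which gives (T3) on the largest letter and (T1) on the
-- others. The flip fails only when `F_{p+1}` lies between the bounds `m + F_g` and `m + F_{g+1}`
-- and `k` has no index below `p + 2`; this is the special step with (T2). For `g ≥ p - 1` the safe
-- sets are cut out by a lower bound on Zeckendorf indices alone, and `ps_sturmWord` identifies them
-- with partial sums of Fibonacci words.

/-- All indices in the Zeckendorf representation of `k` are at least `n`. -/
def ZeckGE (n k : ℕ) : Prop :=
  ∀ i ∈ Nat.zeckendorf k, n ≤ i

theorem zeckGE_zero (n : ℕ) : ZeckGE n 0 := by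
  simp [ZeckGE]

theorem ZeckGE.anti {n n' k : ℕ} (h : ZeckGE n k) (hn : n' ≤ n) : ZeckGE n' k :=
  fun i hi => hn.trans (h i hi)

theorem fib_split {b : ℕ} (hb : 1 ≤ b) : Nat.fib (b + 1) = Nat.fib b + Nat.fib (b - 1) := by
  obtain ⟨c, rfl⟩ := Nat.exists_eq_add_of_le' hb
  rw [Nat.fib_add_two, Nat.add_sub_cancel, add_comm]

theorem two_le_greatestFib {k : ℕ} (hk : 0 < k) : 2 ≤ Nat.greatestFib k :=
  Nat.le_greatestFib.2 hk

/-- Splitting off the largest Fibonacci number. -/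
theorem sub_greatestFib_lt {k : ℕ} (hk : 0 < k) :
    k - Nat.fib (Nat.greatestFib k) < Nat.fib (Nat.greatestFib k - 1) := by
  have h1 := Nat.lt_fib_greatestFib_add_one k
  rw [fib_split (by have := two_le_greatestFib hk; omega)] at h1
  have h2 := Nat.fib_greatestFib_le k
  omega

theorem zeckGE_pos_iff {n k : ℕ} (hk : 0 < k) :
    ZeckGE n k ↔ n ≤ Nat.greatestFib k ∧ ZeckGE n (k - Nat.fib (Nat.greatestFib k)) := by
  unfold ZeckGE
  rw [Nat.zeckendorf_of_pos hk]
  simp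

/-- Peel off the largest part `F_a` of `u`: by induction the remainder plus `v` stays below
`F_{a-1}`, so the total is below `F_{a+1} ≤ F_j`. -/
theorem ZeckGE.add_lt {i j u v : ℕ} (hu : ZeckGE (i + 1) u) (hv : v < Nat.fib i)
    (huj : u < Nat.fib j) (hij : i ≤ j) : u + v < Nat.fib j := by
  induction u using Nat.strong_induction_on generalizing j with
  | _ u ih =>
    rcases Nat.eq_zero_or_pos u with rfl | hpos
    · have := Nat.fib_mono hij
      omega
    · have h2 := two_le_greatestFib hpos
      obtain ⟨h3, h4⟩ := (zeckGE_pos_iff hpos).1 hu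
      have h5 := Nat.fib_greatestFib_le u
      have h6 : 0 < Nat.fib (Nat.greatestFib u) := Nat.fib_pos.2 (by omega)
      have h7 := ih _ (by omega) h4 (sub_greatestFib_lt hpos) (by omega)
      have h8 : Nat.greatestFib u + 1 ≤ j := Nat.greatestFib_lt.2 huj
      have h9 := Nat.fib_mono h8
      rw [fib_split (by omega)] at h9
      omega

/-- The indices of `v` are at most `i - 1`, so there is no carry: the greedy algorithm on `u + v`
peels off the parts of `u` first. -/
theorem zeckendorf_add {i u v : ℕ} (hu : ZeckGE (i + 1) u) (hv : v < Nat.fib i) :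
    Nat.zeckendorf (u + v) = Nat.zeckendorf u ++ Nat.zeckendorf v := by
  induction u using Nat.strong_induction_on with
  | _ u ih =>
    rcases Nat.eq_zero_or_pos u with rfl | hpos
    · simp
    · have h2 := two_le_greatestFib hpos
      obtain ⟨h3, h4⟩ := (zeckGE_pos_iff hpos).1 hu
      have h5 := Nat.fib_greatestFib_le u
      have h6 : 0 < Nat.fib (Nat.greatestFib u) := Nat.fib_pos.2 (by omega)
      have h7 := hu.add_lt hv (Nat.lt_fib_greatestFib_add_one u) (by omega)
      have h8 : Nat.greatestFib (u + v) = Nat.greatestFib u :=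
        ((eq_greatestFib_iff (u + v) _).2 ⟨by omega, h7⟩).symm
      rw [Nat.zeckendorf_of_pos (by omega : 0 < u + v), Nat.zeckendorf_of_pos hpos, h8,
        List.cons_append, ← ih _ (by omega) h4]
      congr 2
      omega

theorem zeckGE_add {i n u v : ℕ} (hu : ZeckGE (i + 1) u) (hv : v < Nat.fib i) :
    ZeckGE n (u + v) ↔ ZeckGE n u ∧ ZeckGE n v := by
  unfold ZeckGE
  rw [zeckendorf_add hu hv]
  simp only [List.mem_append, or_imp, forall_and]

theorem zeckGE_fib {n b : ℕ} (hb : 2 ≤ b) : ZeckGE n (Nat.fib b) ↔ n ≤ b := by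
  have h : Nat.greatestFib (Nat.fib b) = b := Nat.greatestFib_fib (by omega)
  rw [zeckGE_pos_iff (Nat.fib_pos.2 (by omega)), h, Nat.sub_self]
  simp [zeckGE_zero]

theorem zeckGE_two (k : ℕ) : ZeckGE 2 k := by
  induction k using Nat.strong_induction_on with
  | _ k ih =>
    rcases Nat.eq_zero_or_pos k with rfl | hpos
    · exact zeckGE_zero 2
    · have h2 := two_le_greatestFib hpos
      have h6 : 0 < Nat.fib (Nat.greatestFib k) := Nat.fib_pos.2 (by omega)
      exact (zeckGE_pos_iff hpos).2 ⟨h2, ih _ (by omega)⟩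

theorem ZeckGE.fib_le {n k : ℕ} (h : ZeckGE n k) (hk : 0 < k) : Nat.fib n ≤ k :=
  (Nat.fib_mono ((zeckGE_pos_iff hk).1 h).1).trans (Nat.fib_greatestFib_le k)

theorem fib_lt_fib_succ {b : ℕ} (hb : 2 ≤ b) : Nat.fib b < Nat.fib (b + 1) :=
  Nat.fib_lt_fib_succ hb

/-- `F_b` is the smallest part in the Zeckendorf representation of `k`, and `u` is the sum of the
other parts. -/
structure MinPart (k u b : ℕ) : Prop where
  two_le : 2 ≤ b
  rest : ZeckGE (b + 2) u
  eq : k = u + Nat.fib b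

theorem exists_minPart {k : ℕ} (hk : 0 < k) : ∃ u b, MinPart k u b := by
  induction k using Nat.strong_induction_on with
  | _ k ih =>
    have h2 := two_le_greatestFib hk
    have h5 := Nat.fib_greatestFib_le k
    have h6 : 0 < Nat.fib (Nat.greatestFib k) := Nat.fib_pos.2 (by omega)
    set a := Nat.greatestFib k with ha
    rcases Nat.eq_zero_or_pos (k - Nat.fib a) with h0 | hpos
    · exact ⟨0, a, h2, zeckGE_zero _, by omega⟩
    · obtain ⟨u, b, hb⟩ := ih _ (by omega) hpos
      have h7 := sub_greatestFib_lt hk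
      rw [← ha, hb.eq] at h7
      have h8 : b < a - 1 := by
        by_contra hcon
        have := Nat.fib_mono (not_lt.1 hcon)
        omega
      have h9 := hb.eq
      refine ⟨Nat.fib a + u, b, hb.two_le, ?_, by omega⟩
      exact (zeckGE_add (i := a - 1) ((zeckGE_fib h2).2 (by omega)) (by omega)).2
        ⟨(zeckGE_fib h2).2 (by omega), hb.rest⟩

namespace MinPart
variable {k u b : ℕ}

theorem pos (h : MinPart k u b) : 0 < k := by
  have := h.eq
  have : 0 < Nat.fib b := Nat.fib_pos.2 (by have := h.two_le; omega)
  omega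

theorem zeckGE_iff (h : MinPart k u b) {n : ℕ} : ZeckGE n k ↔ n ≤ b := by
  rw [h.eq, zeckGE_add h.rest (fib_lt_fib_succ h.two_le), zeckGE_fib h.two_le]
  exact ⟨fun h => h.2, fun hn => ⟨h.rest.anti (by omega), hn⟩⟩

theorem unique (h : MinPart k u b) {u' b' : ℕ} (h' : MinPart k u' b') : u = u' ∧ b = b' := by
  have h1 := h'.zeckGE_iff.1 (h.zeckGE_iff.2 le_rfl)
  have h2 := h.zeckGE_iff.1 (h'.zeckGE_iff.2 le_rfl)
  obtain rfl : b = b' := by omega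
  have := h.eq
  have := h'.eq
  exact ⟨by omega, rfl⟩

/-- Adding a number with large Zeckendorf indices does not change the smallest part. -/
theorem add_left {i w : ℕ} (h : MinPart k u b) (hw : ZeckGE (i + 1) w) (hk : k < Nat.fib i) :
    MinPart (w + k) (w + u) b := by
  have h1 := h.eq
  have hb : b + 1 ≤ i := by
    by_contra hcon
    have := Nat.fib_mono (show i ≤ b by omega)
    omega
  refine ⟨h.two_le, ?_, by omega⟩
  exact (zeckGE_add hw (by omega)).2 ⟨hw.anti (by omega), h.rest⟩

theorem fib_le (h : MinPart k u b) : Nat.fib b ≤ k := by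
  have := h.eq
  omega

end MinPart

theorem MinPart.of_zeckGE {w b : ℕ} (hb : 2 ≤ b) (hw : ZeckGE (b + 2) w) :
    MinPart (w + Nat.fib b) w b :=
  ⟨hb, hw, rfl⟩

theorem MinPart.add_fib_pred {k u b : ℕ} (h : MinPart k u b) :
    k + Nat.fib (b - 1) = u + Nat.fib (b + 1) := by
  rw [h.eq, fib_split (by have := h.two_le; omega)]
  ring

/-- If `w` has no Zeckendorf index below `n + 1`, then `w + F_n` has none below `n`. -/
theorem ZeckGE.add_fib {n w : ℕ} (hn : 2 ≤ n) (hw : ZeckGE (n + 1) w) :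
    ZeckGE n (w + Nat.fib n) := by
  induction hd : w using Nat.strong_induction_on generalizing n w with
  | _ x ih =>
    subst hd
    by_cases h : ZeckGE (n + 2) w
    · exact (MinPart.of_zeckGE hn h).zeckGE_iff.2 le_rfl
    · rcases Nat.eq_zero_or_pos w with rfl | hpos
      · exact absurd (zeckGE_zero _) h
      · obtain ⟨u, b, hb⟩ := exists_minPart hpos
        have h1 := hb.zeckGE_iff.1 hw
        have h2 : ¬ n + 2 ≤ b := fun h' => h (hb.zeckGE_iff.2 h')
        obtain rfl : b = n + 1 := by omega
        -- `F_{n+1}` is a part of `w`, so adding `F_n` carries to `F_{n+2}`; the induction follows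
        -- the carry upwards through `u`.
        have h3 := hb.add_fib_pred
        rw [Nat.add_sub_cancel] at h3
        rw [h3]
        have h4 := hb.fib_le
        have h6 : 0 < Nat.fib (n + 1) := Nat.fib_pos.2 (by omega)
        exact (ih u (n := n + 1 + 1) (by have := hb.eq; omega) (by omega)
          (hb.rest.anti (by omega)) rfl).anti (by omega)

/-- If `b` is the smallest Zeckendorf index of `k`, then `k + F_{b-1}` has no index below
`b + 1`. -/
theorem MinPart.zeckGE_add_fib_pred {k u b : ℕ} (h : MinPart k u b) :
    ZeckGE (b + 1) (k + Nat.fib (b - 1)) := by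
  rw [h.add_fib_pred]
  exact ZeckGE.add_fib (by have := h.two_le; omega) h.rest

/-! ### The winning threshold -/

open Classical in
/-- The greatest index `i` with `F_i ≤ m + F_b` such that all Zeckendorf indices of `u` exceed
`i`. -/
noncomputable def topIndex (m b u : ℕ) : ℕ :=
  Nat.findGreatest (fun i => ZeckGE (i + 1) u) (Nat.greatestFib (m + Nat.fib b))

theorem le_topIndex_iff {m b u i : ℕ} :
    i ≤ topIndex m b u ↔ Nat.fib i ≤ m + Nat.fib b ∧ ZeckGE (i + 1) u := by
  classical
  unfold topIndex
  rw [← Nat.le_greatestFib]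
  constructor
  · intro h
    refine ⟨h.trans (Nat.findGreatest_le _), ?_⟩
    have h0 : ZeckGE (0 + 1) u := (zeckGE_two u).anti (by omega)
    exact (Nat.findGreatest_spec (P := fun i => ZeckGE (i + 1) u) (Nat.zero_le _) h0).anti
      (Nat.succ_le_succ h)
  · rintro ⟨h1, h2⟩
    exact Nat.le_findGreatest h1 h2

/-- With smaller pile `m` and pile difference `u + F_b`, whose smallest Zeckendorf part is `F_b`,
it pays to remove `F_{b-1}` stones from the smaller pile. -/
def Raisable (m b u : ℕ) : Prop :=
  Odd (topIndex m b u - b)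

/-- The bound `m + F_b` is below `F_{b+1}`, so the top index is at most `b` and the truncated
difference is `0`, which is even. -/
theorem not_raisable_of_lt {m b u : ℕ} (hb : 2 ≤ b) (hm : m < Nat.fib (b - 1)) :
    ¬ Raisable m b u := by
  have h : ¬ b + 1 ≤ topIndex m b u := by
    rw [le_topIndex_iff, fib_split (by omega)]
    omega
  unfold Raisable
  rw [show topIndex m b u - b = 0 by omega]
  simp

/-- Here `F_{b+2}` is a part of `u`, which stops the top index at `b + 1`. -/
theorem raisable_of_carry {m b u : ℕ} (hb : 2 ≤ b) (hm : Nat.fib (b - 1) ≤ m)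
    (hu : ZeckGE (b + 2) u) (hu' : ¬ ZeckGE (b + 3) u) : Raisable m b u := by
  have h1 : b + 1 ≤ topIndex m b u := by
    rw [le_topIndex_iff, fib_split (by omega)]
    exact ⟨by omega, hu⟩
  have h2 : ¬ b + 2 ≤ topIndex m b u := fun h => hu' (le_topIndex_iff.1 h).2
  unfold Raisable
  rw [show topIndex m b u - b = 1 by omega]
  exact odd_one

/-- The quantity `m + F_b` is invariant under `(m, b) ↦ (m - F_{b-1}, b + 1)`, so the top index
stays put while `b` grows by one. -/
theorem raisable_iff_not_raisable_succ {m b u : ℕ} (hb : 2 ≤ b) (hm : Nat.fib (b - 1) ≤ m)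
    (hu : ZeckGE (b + 3) u) : Raisable m b u ↔ ¬ Raisable (m - Nat.fib (b - 1)) (b + 1) u := by
  have h1 : b + 1 ≤ topIndex m b u := by
    rw [le_topIndex_iff, fib_split (by omega)]
    exact ⟨by omega, hu.anti (by omega)⟩
  have h2 : topIndex (m - Nat.fib (b - 1)) (b + 1) u = topIndex m b u := by
    unfold topIndex
    rw [fib_split (by omega),
      show m - Nat.fib (b - 1) + (Nat.fib b + Nat.fib (b - 1)) = m + Nat.fib b by omega]
  unfold Raisable
  rw [h2, show topIndex m b u - b = topIndex m b u - (b + 1) + 1 by omega, Nat.odd_add_one]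

open Classical in
/-- The index of the least number of stones whose removal can win. -/
noncomputable def threshold (m b u : ℕ) : ℕ :=
  if Raisable m b u then b - 1 else b

theorem threshold_le (m b u : ℕ) : threshold m b u ≤ b := by
  unfold threshold
  split <;> omega

theorem pred_le_threshold (m b u : ℕ) : b - 1 ≤ threshold m b u := by
  unfold threshold
  split <;> omega

theorem threshold_of_raisable {m b u : ℕ} (h : Raisable m b u) : threshold m b u = b - 1 :=
  if_pos h

theorem threshold_of_not_raisable {m b u : ℕ} (h : ¬ Raisable m b u) : threshold m b u = b :=
  if_neg h

/-- The candidate description of the `P`-positions `(m, m + k; r)`. -/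
def Safe (m k r : ℕ) : Prop :=
  ∀ u b, MinPart k u b → r < Nat.fib (threshold m b u)

theorem safe_zero (m r : ℕ) : Safe m 0 r :=
  fun _ _ h => absurd h.pos (lt_irrefl 0)

theorem MinPart.safe_iff {m k r u b : ℕ} (h : MinPart k u b) :
    Safe m k r ↔ r < Nat.fib (threshold m b u) := by
  refine ⟨fun hs => hs u b h, fun hr u' b' h' => ?_⟩
  obtain ⟨rfl, rfl⟩ := h.unique h'
  exact hr

theorem MinPart.not_safe {m k r u b : ℕ} (h : MinPart k u b) (hr : Nat.fib b ≤ r) :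
    ¬ Safe m k r := by
  rw [h.safe_iff, not_lt]
  exact (Nat.fib_mono (threshold_le m b u)).trans hr

theorem ZeckGE.safe {m k n r : ℕ} (h : ZeckGE (n + 1) k) (hr : r < Nat.fib n) : Safe m k r := by
  intro u b hb
  have h1 := hb.zeckGE_iff.1 h
  exact hr.trans_le (Nat.fib_mono ((by omega : n ≤ b - 1).trans (pred_le_threshold m b u)))

theorem Safe.lt_fib {m k r u b : ℕ} (hs : Safe m k r) (h : MinPart k u b) : r < Nat.fib b :=
  (hs u b h).trans_le (Nat.fib_mono (threshold_le m b u))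

theorem fib_le_two_mul_pred {b : ℕ} (hb : 1 ≤ b) : Nat.fib (b + 1) ≤ 2 * Nat.fib b := by
  rw [fib_split hb]
  have := Nat.fib_mono (show b - 1 ≤ b by omega)
  omega

theorem two_mul_fib_lt {b : ℕ} (hb : 2 ≤ b) : 2 * Nat.fib b < Nat.fib (b + 2) := by
  rw [Nat.fib_add_two]
  have := fib_lt_fib_succ hb
  omega

/-! ### Moves from safe positions -/

/-- If `2s` were below the smallest part of `k - s`, then adding `s` back would cause no carry, so
the parts of `s` would be parts of `k`; but `s ≤ r` is below the smallest part of `k`. -/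
theorem Safe.not_safe_sub {m k r s : ℕ} (hs : Safe m k r) (h1 : 1 ≤ s) (hr : s ≤ r) (hk : s ≤ k) :
    ¬ Safe m (k - s) (2 * s) := by
  obtain ⟨u, b, hb⟩ := exists_minPart (show 0 < k by omega)
  have h2 := hs.lt_fib hb
  have h3 := hb.fib_le
  obtain ⟨u', b', hb'⟩ := exists_minPart (show 0 < k - s by omega)
  refine hb'.not_safe (not_lt.1 fun hcon => ?_)
  have h4 := hb'.two_le
  have h5 : s < Nat.fib (b' - 1) := by
    have := fib_le_two_mul_pred (show 1 ≤ b' - 1 by omega)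
    rw [Nat.sub_add_cancel (by omega)] at this
    omega
  have h6 : ZeckGE (b' - 1 + 1) (k - s) := hb'.zeckGE_iff.2 (by omega)
  have h7 : ZeckGE b (k - s + s) := by
    rw [Nat.sub_add_cancel hk]
    exact hb.zeckGE_iff.2 le_rfl
  have h8 := ((zeckGE_add h6 h5).1 h7).2.fib_le h1
  omega

/-- Compare `s` with `F_{b-1}`. If smaller, the smallest part of `s` becomes that of `k + s`. If
equal, safety rules out raisability, so the new position is raisable and its threshold `F_b` is at
most `2s`. If larger, `F_{b-1}` is absorbed into `u + F_{b+1}` and the smallest part of the excess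
`s - F_{b-1}` becomes that of `k + s`. -/
theorem Safe.not_safe_add {m k r s : ℕ} (hs : Safe m k r) (h1 : 1 ≤ s) (hr : s ≤ r) (hm : s ≤ m) :
    ¬ Safe (m - s) (k + s) (2 * s) := by
  obtain ⟨u', b', hb'⟩ := exists_minPart h1
  have h2' := hb'.fib_le
  rcases Nat.eq_zero_or_pos k with rfl | hk
  · rw [zero_add]
    exact hb'.not_safe (by omega)
  obtain ⟨u, b, hb⟩ := exists_minPart hk
  have h2 := hs u b hb
  have h3 := hb.two_le
  have h4 := hs.lt_fib hb
  rcases lt_trichotomy s (Nat.fib (b - 1)) with hlt | heq | hgt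
  · have h5 : ZeckGE (b - 1 + 1) k := hb.zeckGE_iff.2 (by omega)
    exact (hb'.add_left h5 hlt).not_safe (by omega)
  · have hR : ¬ Raisable m b u := fun hR => by
      rw [threshold_of_raisable hR] at h2
      omega
    have hu : ZeckGE (b + 3) u := by
      by_contra hu
      exact hR (raisable_of_carry h3 (by omega) hb.rest hu)
    have hR' : Raisable (m - s) (b + 1) u := by
      by_contra hR'
      rw [heq] at hR'
      exact hR ((raisable_iff_not_raisable_succ h3 (by omega) hu).2 hR')
    have h5 : MinPart (k + s) u (b + 1) := by
      rw [heq, hb.add_fib_pred]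
      exact MinPart.of_zeckGE (by omega) hu
    rw [h5.safe_iff, threshold_of_raisable hR', Nat.add_sub_cancel, heq, not_lt]
    have := fib_le_two_mul_pred (show 1 ≤ b - 1 by omega)
    rwa [Nat.sub_add_cancel (by omega)] at this
  · have h5 : ZeckGE b (u + Nat.fib (b + 1)) :=
      (ZeckGE.add_fib (by omega) hb.rest).anti (by omega)
    have h6 := hb.add_fib_pred
    have h7 : 3 ≤ b := by
      by_contra hcon
      obtain rfl : b = 2 := by omega
      simp at h4 hgt
      omega
    have h8 := fib_split (show 1 ≤ b - 1 by omega)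
    rw [Nat.sub_add_cancel (by omega)] at h8
    obtain ⟨u₂, b₂, hb₂⟩ := exists_minPart (show 0 < s - Nat.fib (b - 1) by omega)
    have h9 : ZeckGE (b - 1 + 1) (u + Nat.fib (b + 1)) := h5.anti (by omega)
    have h11 := Nat.fib_mono (Nat.sub_le (b - 1) 1)
    have h10 := hb₂.add_left h9 (by omega)
    rw [← h6, show k + Nat.fib (b - 1) + (s - Nat.fib (b - 1)) = k + s by omega] at h10
    have := hb₂.fib_le
    exact h10.not_safe (by omega)

/-- The larger pile can become the smaller one only from `k = 0`, since a safe `k > 0` has `r < F_b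
≤ k`. -/
theorem Safe.not_safe_cross {m m' k r s : ℕ} (hs : Safe m k r) (hr : s ≤ r) (hk : k < s) :
    ¬ Safe m' (s - k) (2 * s) := by
  rcases Nat.eq_zero_or_pos k with rfl | hpos
  · obtain ⟨u', b', hb'⟩ := exists_minPart (show 0 < s by omega)
    have := hb'.fib_le
    exact hb'.not_safe (by omega)
  · obtain ⟨u, b, hb⟩ := exists_minPart hpos
    have := hs.lt_fib hb
    have := hb.fib_le
    omega

/-! ### Moves from unsafe positions -/

theorem exists_safe_of_not_safe {m k r : ℕ} (hs : ¬ Safe m k r) :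
    (∃ s, 1 ≤ s ∧ s ≤ r ∧ s ≤ k ∧ Safe m (k - s) (2 * s)) ∨
      ∃ s, 1 ≤ s ∧ s ≤ r ∧ s ≤ m ∧ Safe (m - s) (k + s) (2 * s) := by
  have hk : 0 < k := Nat.pos_of_ne_zero fun h => hs (h ▸ safe_zero m r)
  obtain ⟨u, b, hb⟩ := exists_minPart hk
  have hb2 := hb.two_le
  rw [hb.safe_iff, not_lt] at hs
  have hpred : 1 ≤ Nat.fib (b - 1) := Nat.fib_pos.2 (by omega)
  by_cases hcarry : Nat.fib (b - 1) ≤ m ∧ ¬ ZeckGE (b + 3) u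
  · obtain ⟨hm, hu⟩ := hcarry
    rw [threshold_of_raisable (raisable_of_carry hb2 hm hb.rest hu)] at hs
    refine Or.inr ⟨_, hpred, hs, hm, ?_⟩
    have hu0 : 0 < u := Nat.pos_of_ne_zero fun h => hu (h ▸ zeckGE_zero _)
    obtain ⟨u₂, c, hc⟩ := exists_minPart hu0
    have h1 := hc.zeckGE_iff.1 hb.rest
    have h2 : ¬ b + 3 ≤ c := fun h => hu (hc.zeckGE_iff.2 h)
    obtain rfl : c = b + 2 := by omega
    -- `F_{b+1}` merges with the part `F_{b+2}` of `u`, pushing all indices up to at least `b + 3`: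
    -- safe whatever the raisability.
    have h3 := hc.zeckGE_add_fib_pred
    rw [hb.add_fib_pred]
    refine ZeckGE.safe (n := b + 2) h3 ?_
    exact (Nat.mul_le_mul_left 2 (Nat.fib_mono (Nat.sub_le b 1))).trans_lt (two_mul_fib_lt hb2)
  -- The condition `3 ≤ b` gives `2 F_{b-1} < F_{b+1}`. For `b = 2` the thresholds `F_1` and `F_2`
  -- coincide, so removing `F_b` is allowed in any case.
  · by_cases hR : Raisable m b u ∧ 3 ≤ b
    · obtain ⟨hR, hb3⟩ := hR
      have hm : Nat.fib (b - 1) ≤ m := not_lt.1 fun h => not_raisable_of_lt hb2 h hR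
      have hu : ZeckGE (b + 3) u := by
        by_contra hu
        exact hcarry ⟨hm, hu⟩
      rw [threshold_of_raisable hR] at hs
      refine Or.inr ⟨_, hpred, hs, hm, ?_⟩
      rw [hb.add_fib_pred, (MinPart.of_zeckGE (by omega) hu).safe_iff, threshold_of_not_raisable
        ((raisable_iff_not_raisable_succ hb2 hm hu).1 hR)]
      have := two_mul_fib_lt (show 2 ≤ b - 1 by omega)
      rwa [show b - 1 + 2 = b + 1 by omega] at this
    · have hr : Nat.fib b ≤ r := by
        by_cases h : Raisable m b u
        · obtain rfl : b = 2 := by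
            by_contra hne
            exact hR ⟨h, by omega⟩
          rw [threshold_of_raisable h] at hs
          simpa using hs
        · rwa [threshold_of_not_raisable h] at hs
      refine Or.inl ⟨_, hpred.trans (Nat.fib_mono (Nat.sub_le b 1)), hr, hb.fib_le, ?_⟩
      rw [show k - Nat.fib b = u by have := hb.eq; omega]
      intro u₂ c hc
      have h1 := hc.zeckGE_iff.1 hb.rest
      refine (two_mul_fib_lt hb2).trans_le (Nat.fib_mono ?_)
      have h2 := pred_le_threshold m c u₂
      -- Failure requires `F_{b+2}` to be a part of `u` and raisable; then `F_{b+1} ≤ m`, which is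
      -- the carry case already excluded.
      by_contra hlt
      obtain rfl : c = b + 2 := by omega
      have h3 : Raisable m (b + 2) u₂ := by
        by_contra h
        rw [threshold_of_not_raisable h] at hlt
        omega
      refine hcarry ⟨?_, fun h => ?_⟩
      · have h4 : Nat.fib (b + 2 - 1) ≤ m := not_lt.1 fun h => not_raisable_of_lt (by omega) h h3
        exact (Nat.fib_mono (by omega)).trans h4
      · have := hc.zeckGE_iff.1 h
        omega

/-! ### The solution of the game -/

/-- The candidate description of the `P`-positions, for unordered piles. -/
def SafePos (G : Pos) : Prop :=
  Safe (min G.left G.right) (max G.left G.right - min G.left G.right) G.cap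

theorem safePos_left (m k r : ℕ) : SafePos ⟨m, m + k, r⟩ ↔ Safe m k r := by
  simp [SafePos]

theorem safePos_right (m k r : ℕ) : SafePos ⟨m + k, m, r⟩ ↔ Safe m k r := by
  simp [SafePos]

theorem SafePos.not_of_move {G G' : Pos} (h : SafePos G) (hm : Move G G') : ¬ SafePos G' := by
  have key : ∀ a b r s, 1 ≤ s → s ≤ r → s ≤ a → SafePos ⟨a, b, r⟩ →
      ¬ SafePos ⟨a - s, b, 2 * s⟩ := by
    intro a b r s h1 hr ha hs
    rcases le_total a b with hab | hab
    · obtain ⟨k, rfl⟩ := Nat.exists_eq_add_of_le hab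
      rw [safePos_left] at hs
      rw [show a + k = a - s + (k + s) by omega, safePos_left]
      exact hs.not_safe_add h1 hr ha
    · obtain ⟨k, rfl⟩ := Nat.exists_eq_add_of_le hab
      rw [safePos_right] at hs
      rcases le_or_gt s k with hsk | hsk
      · rw [show b + k - s = b + (k - s) by omega, safePos_right]
        exact hs.not_safe_sub h1 hr hsk
      · have : SafePos ⟨b + k - s, b, 2 * s⟩ ↔ Safe (b + k - s) (s - k) (2 * s) := by
          rw [← safePos_left, show b + k - s + (s - k) = b by omega]
        rw [this]
        exact hs.not_safe_cross hr hsk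
  have symm : ∀ a b r, SafePos ⟨a, b, r⟩ ↔ SafePos ⟨b, a, r⟩ := by
    intro a b r
    simp [SafePos, min_comm, max_comm]
  cases hm with
  | fromLeft a b r s h1 hr ha => exact key a b r s h1 hr ha h
  | fromRight a b r s h1 hr hb =>
    rw [symm]
    exact key b a r s h1 hr hb ((symm a b r).1 h)

theorem exists_move_of_not_safePos {G : Pos} (h : ¬ SafePos G) :
    ∃ G', Move G G' ∧ SafePos G' := by
  obtain ⟨a, b, r⟩ := G
  rcases le_total a b with hab | hab
  · obtain ⟨k, rfl⟩ := Nat.exists_eq_add_of_le hab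
    rw [safePos_left] at h
    rcases exists_safe_of_not_safe h with ⟨s, h1, hr, hk, hs⟩ | ⟨s, h1, hr, hk, hs⟩
    · refine ⟨_, Move.fromRight _ _ r s h1 hr (by omega), ?_⟩
      rwa [show a + k - s = a + (k - s) by omega, safePos_left]
    · refine ⟨_, Move.fromLeft _ _ r s h1 hr hk, ?_⟩
      rwa [show a + k = a - s + (k + s) by omega, safePos_left]
  · obtain ⟨k, rfl⟩ := Nat.exists_eq_add_of_le hab
    rw [safePos_right] at h
    rcases exists_safe_of_not_safe h with ⟨s, h1, hr, hk, hs⟩ | ⟨s, h1, hr, hk, hs⟩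
    · refine ⟨_, Move.fromLeft _ _ r s h1 hr (by omega), ?_⟩
      rwa [show b + k - s = b + (k - s) by omega, safePos_right]
    · refine ⟨_, Move.fromRight _ _ r s h1 hr hk, ?_⟩
      rwa [show b + k = b - s + (k + s) by omega, safePos_right]

theorem Move.sum_lt {G G' : Pos} (h : Move G G') : G'.left + G'.right < G.left + G.right := by
  cases h <;> dsimp only <;> omega

theorem isP_iff_safePos_and_isN_iff (G : Pos) : (IsP G ↔ SafePos G) ∧ (IsN G ↔ ¬ SafePos G) := by
  induction hn : G.left + G.right using Nat.strong_induction_on generalizing G with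
  | _ n ih =>
    subst hn
    have ih' : ∀ G', Move G G' → (IsP G' ↔ SafePos G') ∧ (IsN G' ↔ ¬ SafePos G') :=
      fun G' hm => ih _ hm.sum_lt G' rfl
    constructor
    · constructor
      · rintro ⟨_, h⟩
        by_contra hs
        obtain ⟨G', hm, hs'⟩ := exists_move_of_not_safePos hs
        exact (ih' G' hm).2.1 (h G' hm) hs'
      · exact fun hs => IsP.intro G fun G' hm => (ih' G' hm).2.2 (hs.not_of_move hm)
    · constructor
      · rintro ⟨_, G', hm, h⟩ hs
        exact hs.not_of_move hm ((ih' G' hm).1.1 h)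
      · intro hs
        obtain ⟨G', hm, hs'⟩ := exists_move_of_not_safePos hs
        exact IsN.intro G G' hm ((ih' G' hm).1.2 hs')

theorem isP_iff_safe (m k r : ℕ) : IsP ⟨m, m + k, r⟩ ↔ Safe m k r := by
  rw [(isP_iff_safePos_and_isN_iff _).1, safePos_left]

/-! ### Words determined by their partial sums -/

/-- Every letter of the word is determined by the sum of the preceding letters. -/
def Follows (W nxt : ℕ → ℕ) : Prop :=
  ∀ i, W i = nxt (partialSum W i)

theorem partialSum_succ (W : ℕ → ℕ) (n : ℕ) :
    partialSum W (n + 1) = partialSum W n + Nat.fib (W n) :=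
  Finset.sum_range_succ _ _

/-- The partial sums walk through `S` from each element to the next one, skipping none. -/
theorem Follows.ps_eq {W nxt : ℕ → ℕ} (hW : Follows W nxt) {S : Set ℕ} (h0 : 0 ∈ S)
    (hS : ∀ k ∈ S, 0 < Nat.fib (nxt k) ∧ k + Nat.fib (nxt k) ∈ S ∧
      ∀ s, 0 < s → s < Nat.fib (nxt k) → k + s ∉ S) : PS W = S := by
  have hmem : ∀ n, partialSum W n ∈ S := by
    intro n
    induction n with
    | zero => simpa [partialSum] using h0
    | succ n ih =>
      rw [partialSum_succ, hW n]
      exact (hS _ ih).2.1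
  have hgrow : ∀ n, n ≤ partialSum W n := by
    intro n
    induction n with
    | zero => simp
    | succ n ih =>
      have := (hS _ (hmem n)).1
      rw [partialSum_succ, hW n]
      omega
  ext k
  constructor
  · rintro ⟨n, rfl⟩
    exact hmem n
  · intro hk
    have hex : ∃ n, k < partialSum W n := ⟨k + 1, hgrow (k + 1)⟩
    classical
    have h1 := Nat.find_spec hex
    obtain ⟨n, hn⟩ : ∃ n, Nat.find hex = n + 1 := by
      refine Nat.exists_eq_succ_of_ne_zero fun h => ?_
      rw [h] at h1
      simp [partialSum] at h1
    have h2 := Nat.find_min hex (show n < Nat.find hex by omega)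
    rw [hn, partialSum_succ, hW n] at h1
    by_contra hcon
    have h3 : k ≠ partialSum W n := fun h => hcon ⟨n, h⟩
    refine (hS _ (hmem n)).2.2 (k - partialSum W n) (by omega) (by omega) ?_
    rwa [show partialSum W n + (k - partialSum W n) = k by omega]

/-- The sum of the letters of a finite word. -/
def listSum (l : List ℕ) : ℕ :=
  (l.map Nat.fib).sum

@[simp] theorem listSum_nil : listSum [] = 0 := rfl

@[simp] theorem listSum_cons (c : ℕ) (l : List ℕ) : listSum (c :: l) = Nat.fib c + listSum l :=
  rfl

@[simp] theorem listSum_append (l l' : List ℕ) : listSum (l ++ l') = listSum l + listSum l' := by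
  simp [listSum]

/-- Every letter of the finite word, placed after letters of sum `k`, is determined by the sum of
the preceding letters. -/
def ListFollows (nxt : ℕ → ℕ) : ℕ → List ℕ → Prop
  | _, [] => True
  | k, c :: l => c = nxt k ∧ ListFollows nxt (k + Nat.fib c) l

theorem listFollows_append {nxt : ℕ → ℕ} {k : ℕ} {l l' : List ℕ} :
    ListFollows nxt k (l ++ l') ↔ ListFollows nxt k l ∧ ListFollows nxt (k + listSum l) l' := by
  induction l generalizing k with
  | nil => simp [ListFollows]
  | cons c l ih => simp [ListFollows, ih, and_assoc, add_assoc]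

theorem ListFollows.shift {nxt : ℕ → ℕ} (hpos : ∀ s, 0 < Nat.fib (nxt s)) {K k : ℕ} {l : List ℕ}
    (h : ListFollows nxt k l) (hK : ∀ s, s < k + listSum l → nxt (K + s) = nxt s) :
    ListFollows nxt (K + k) l := by
  induction l generalizing k with
  | nil => trivial
  | cons c l ih =>
    obtain ⟨rfl, h2⟩ := h
    have := hpos k
    rw [listSum_cons] at hK
    refine ⟨(hK k (by omega)).symm, ?_⟩
    rw [add_assoc]
    exact ih h2 fun s hs => hK s (by omega)

theorem ListFollows.getElem {nxt : ℕ → ℕ} {k : ℕ} {l : List ℕ} (h : ListFollows nxt k l) {t : ℕ}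
    (ht : t < l.length) : l[t] = nxt (k + listSum (l.take t)) := by
  induction l generalizing k t with
  | nil => simp at ht
  | cons c l ih =>
    cases t with
    | zero => simpa using h.1
    | succ t => simpa [add_assoc] using ih h.2 (by simpa using ht)

/-! ### Limits of finite words -/

section Limit

variable {L : ℕ → List ℕ} {d : ℕ} {W : ℕ → ℕ}

theorem limit_getElem (hW : ∀ n, W n = (L n).getD n d) (hp : ∀ n, L n <+: L (n + 1))
    (hl : ∀ n, n < (L n).length) {n t : ℕ} (ht : t < (L n).length) : W t = (L n)[t] := by
  have hmono : ∀ i j, i ≤ j → L i <+: L j := fun i j hij => by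
    induction hij with
    | refl => exact List.prefix_refl _
    | step _ ih => exact ih.trans (hp _)
  rw [hW, List.getD_eq_getElem _ _ (hl t)]
  rcases le_total t n with h | h
  · exact (hmono _ _ h).getElem _
  · exact ((hmono _ _ h).getElem _).symm

theorem limit_partialSum (hW : ∀ n, W n = (L n).getD n d) (hp : ∀ n, L n <+: L (n + 1))
    (hl : ∀ n, n < (L n).length) {n t : ℕ} (ht : t ≤ (L n).length) :
    partialSum W t = listSum ((L n).take t) := by
  induction t with
  | zero => simp [partialSum]
  | succ t ih =>
    rw [partialSum_succ, ih (by omega), limit_getElem hW hp hl (show t < (L n).length by omega),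
      List.take_succ_eq_append_getElem (by omega), listSum_append, listSum_cons, listSum_nil,
      add_zero]

theorem limit_follows (hW : ∀ n, W n = (L n).getD n d) (hp : ∀ n, L n <+: L (n + 1))
    (hl : ∀ n, n < (L n).length) {nxt : ℕ → ℕ} (h : ∀ n, ListFollows nxt 0 (L n)) :
    Follows W nxt := by
  intro i
  rw [limit_getElem hW hp hl (hl i), limit_partialSum hW hp hl (hl i).le, (h i).getElem (hl i),
    zero_add]

end Limit

/-! ### Fibonacci words -/

theorem fibPrefix_prefix (x y n : ℕ) : fibPrefix x y n <+: fibPrefix x y (n + 1) := by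
  cases n with
  | zero => simp [fibPrefix]
  | succ n => exact List.prefix_append _ _

theorem lt_length_fibPrefix (x y n : ℕ) : n < (fibPrefix x y n).length := by
  induction n using Nat.twoStepInduction with
  | zero => simp [fibPrefix]
  | one => simp [fibPrefix]
  | more n ih1 ih2 =>
    rw [fibPrefix, List.length_append]
    omega

theorem listSum_fibPrefix (a n : ℕ) : listSum (fibPrefix (a + 1) a n) = Nat.fib (a + n + 1) := by
  induction n using Nat.twoStepInduction with
  | zero => simp [fibPrefix]
  | one =>
    rw [Nat.fib_add_two, add_comm (Nat.fib a)]
    simp [fibPrefix]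
  | more n ih1 ih2 =>
    rw [fibPrefix, listSum_append, ih1, ih2, show a + (n + 2) + 1 = a + n + 1 + 2 by ring,
      Nat.fib_add_two, show a + (n + 1) + 1 = a + n + 1 + 1 by ring, add_comm]

open Classical in
/-- The letter of `w_a` after letters of sum `k`. -/
noncomputable def sturmNext (a k : ℕ) : ℕ :=
  if ZeckGE (a + 2) k then a + 1 else a

/-- In `S_{n+2} = S_{n+1} S_n` the second factor starts after the sum `F_{a+n+2}`. Sums inside it
before a letter are below `F_{a+n+1}`, so no carry occurs and the rule sees the same small indices
as at the start. -/
theorem listFollows_fibPrefix {a : ℕ} (ha : 1 ≤ a) (n : ℕ) :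
    ListFollows (sturmNext a) 0 (fibPrefix (a + 1) a n) := by
  have h0 : sturmNext a 0 = a + 1 := if_pos (zeckGE_zero _)
  induction n using Nat.twoStepInduction with
  | zero => simp [fibPrefix, ListFollows, h0]
  | one =>
    have h1 : sturmNext a (Nat.fib (a + 1)) = a :=
      if_neg fun h => by
        have := (zeckGE_fib (by omega)).1 h
        omega
    simp [fibPrefix, ListFollows, h0, h1]
  | more n ih1 ih2 =>
    rw [fibPrefix, listFollows_append, listSum_fibPrefix]
    refine ⟨ih2, ?_⟩
    rw [add_comm]
    refine ih1.shift (fun s => ?_) fun s hs => ?_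
    · unfold sturmNext
      split <;> exact Nat.fib_pos.2 (by omega)
    · rw [listSum_fibPrefix, zero_add] at hs
      have h1 : ZeckGE (a + 2) (Nat.fib (a + (n + 1) + 1)) := (zeckGE_fib (by omega)).2 (by omega)
      have h2 : ZeckGE (a + n + 1 + 1) (Nat.fib (a + (n + 1) + 1)) :=
        (zeckGE_fib (by omega)).2 (by omega)
      have h3 : ZeckGE (a + 2) (Nat.fib (a + (n + 1) + 1) + s) ↔ ZeckGE (a + 2) s :=
        (zeckGE_add h2 hs).trans (and_iff_right h1)
      unfold sturmNext
      by_cases h : ZeckGE (a + 2) s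
      · rw [if_pos h, if_pos (h3.2 h)]
      · rw [if_neg h, if_neg fun h' => h (h3.1 h')]

theorem follows_sturmWord {a : ℕ} (ha : 1 ≤ a) : Follows (sturmWord a) (sturmNext a) :=
  limit_follows (fun _ => rfl) (fibPrefix_prefix _ _) (lt_length_fibPrefix _ _)
    (listFollows_fibPrefix ha)

theorem ps_sturmWord {a : ℕ} (ha : 1 ≤ a) : PS (sturmWord a) = {k | ZeckGE (a + 1) k} := by
  refine (follows_sturmWord ha).ps_eq (zeckGE_zero _) fun k hk => ?_
  have hk : ZeckGE (a + 1) k := hk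
  by_cases h : ZeckGE (a + 2) k
  · rw [show sturmNext a k = a + 1 from if_pos h]
    refine ⟨Nat.fib_pos.2 (by omega), ZeckGE.add_fib (by omega) h, fun s h0 hs hks => ?_⟩
    have := ((zeckGE_add h hs).1 hks).2.fib_le h0
    omega
  · rw [show sturmNext a k = a from if_neg h]
    have hpos : 0 < k := Nat.pos_of_ne_zero fun h' => h (h' ▸ zeckGE_zero _)
    obtain ⟨u, b, hb⟩ := exists_minPart hpos
    have h1 := hb.zeckGE_iff.1 hk
    have h2 : ¬ a + 2 ≤ b := fun h' => h (hb.zeckGE_iff.2 h')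
    obtain rfl : b = a + 1 := by omega
    refine ⟨Nat.fib_pos.2 (by omega), ?_, fun s h0 hs hks => ?_⟩
    · exact hb.zeckGE_add_fib_pred.anti (by omega)
    · have := ((zeckGE_add hk hs).1 hks).2.fib_le h0
      have := Nat.fib_mono (show a ≤ a + 1 by omega)
      omega

/-! ### Concatenations of blocks -/

theorem flatMap_range_succ (B : ℕ → List ℕ) (n : ℕ) :
    (List.range (n + 1)).flatMap B = (List.range n).flatMap B ++ B n := by
  simp [List.range_succ]

theorem le_length_flatMap_range {B : ℕ → List ℕ} (hB : ∀ n, B n ≠ []) (n : ℕ) :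
    n ≤ ((List.range n).flatMap B).length := by
  induction n with
  | zero => simp
  | succ n ih =>
    rw [flatMap_range_succ, List.length_append]
    have := List.length_pos_of_ne_nil (hB n)
    omega

theorem listSum_flatMap_range {B : ℕ → List ℕ} {w : ℕ → ℕ}
    (hB : ∀ n, listSum (B n) = Nat.fib (w n)) (n : ℕ) :
    listSum ((List.range n).flatMap B) = partialSum w n := by
  induction n with
  | zero => simp [partialSum]
  | succ n ih => rw [flatMap_range_succ, listSum_append, ih, hB, partialSum_succ]

section Concat

variable {B : ℕ → List ℕ} {w : ℕ → ℕ}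

theorem follows_concatWord (hne : ∀ n, B n ≠ []) (hB : ∀ n, listSum (B n) = Nat.fib (w n))
    {nxt : ℕ → ℕ} (h : ∀ n, ListFollows nxt (partialSum w n) (B n)) :
    Follows (concatWord B) nxt := by
  refine limit_follows (L := fun n => (List.range (n + 1)).flatMap B) (fun _ => rfl)
    (fun n => ?_) (fun n => le_length_flatMap_range hne (n + 1)) fun n => ?_
  · rw [flatMap_range_succ B (n + 1)]
    exact List.prefix_append _ _
  · generalize n + 1 = N
    induction N with
    | zero => trivial
    | succ N ih =>
      rw [flatMap_range_succ, listFollows_append, listSum_flatMap_range hB, zero_add]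
      exact ⟨ih, h N⟩

theorem concatWord_mem (hne : ∀ n, B n ≠ []) (t : ℕ) : ∃ n, concatWord B t ∈ B n := by
  have h1 := le_length_flatMap_range hne (t + 1)
  have h2 : concatWord B t ∈ (List.range (t + 1)).flatMap B := by
    unfold concatWord
    rw [List.getD_eq_getElem _ _ (by omega)]
    exact List.getElem_mem _
  obtain ⟨n, -, hn⟩ := List.mem_flatMap.1 h2
  exact ⟨n, hn⟩

theorem partialSum_concatWord (hne : ∀ n, B n ≠ []) (hB : ∀ n, listSum (B n) = Nat.fib (w n))
    (n : ℕ) : ∃ t, partialSum (concatWord B) t = partialSum w n := by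
  refine ⟨((List.range n).flatMap B).length, ?_⟩
  have hle : ((List.range n).flatMap B).length ≤ ((List.range (n + 1)).flatMap B).length := by
    rw [flatMap_range_succ, List.length_append]
    omega
  rw [limit_partialSum (L := fun n => (List.range (n + 1)).flatMap B) (d := 0)
    (W := concatWord B) (fun _ => rfl) (fun n => ?_) (fun n => le_length_flatMap_range hne (n + 1)) hle,
    ← listSum_flatMap_range hB, flatMap_range_succ, List.take_left]
  rw [flatMap_range_succ B (n + 1)]
  exact List.prefix_append _ _

end Concat

/-- A word of letters with values at most `1` and unbounded partial sums has all partial sums. -/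
theorem ps_eq_univ {W : ℕ → ℕ} (h1 : ∀ i, Nat.fib (W i) ≤ 1)
    (h2 : ∀ k, ∃ n, k ≤ partialSum W n) : PS W = Set.univ := by
  refine Set.eq_univ_of_forall fun k => ?_
  classical
  have h3 := Nat.find_spec (h2 k)
  refine ⟨Nat.find (h2 k), le_antisymm h3 ?_⟩
  rcases hn : Nat.find (h2 k) with _ | n
  · simp [partialSum]
  · have h4 := Nat.find_min (h2 k) (show n < Nat.find (h2 k) by omega)
    have h5 := h1 n
    rw [partialSum_succ]
    omega

/-! ### The letters of the hybrid words -/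

/-- The pile differences `k` for which `(m, m + k; r)` is a `P`-position when `F_g ≤ r < F_{g+1}`. -/
def safeSet (m g : ℕ) : Set ℕ :=
  {k | ∀ u b, MinPart k u b → g + 1 ≤ threshold m b u}

theorem safe_iff_mem_safeSet (m k r : ℕ) : Safe m k r ↔ k ∈ safeSet m (Nat.greatestFib r) := by
  refine forall₂_congr fun u b => imp_congr_right fun _ => ?_
  rw [Nat.succ_le_iff, Nat.greatestFib_lt]

theorem zero_mem_safeSet (m g : ℕ) : 0 ∈ safeSet m g :=
  fun _ _ h => absurd h.pos (lt_irrefl 0)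

theorem zeckGE_of_minPart {n k : ℕ} (h : ∀ u b, MinPart k u b → n ≤ b) : ZeckGE n k := by
  rcases Nat.eq_zero_or_pos k with rfl | hk
  · exact zeckGE_zero n
  · obtain ⟨u, b, hb⟩ := exists_minPart hk
    exact hb.zeckGE_iff.2 (h u b hb)

theorem zeckGE_of_mem_safeSet {m g k : ℕ} (h : k ∈ safeSet m g) : ZeckGE (g + 1) k :=
  zeckGE_of_minPart fun u b hb => (h u b hb).trans (threshold_le m b u)

theorem ZeckGE.mem_safeSet {m g k : ℕ} (h : ZeckGE (g + 2) k) : k ∈ safeSet m g := by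
  intro u b hb
  have := hb.zeckGE_iff.1 h
  exact (by omega : g + 1 ≤ b - 1).trans (pred_le_threshold m b u)

theorem MinPart.mem_safeSet_iff {m g k u b : ℕ} (h : MinPart k u b) :
    k ∈ safeSet m g ↔ g + 1 ≤ threshold m b u := by
  refine ⟨fun hs => hs u b h, fun hr u' b' h' => ?_⟩
  obtain ⟨rfl, rfl⟩ := h.unique h'
  exact hr

open Classical in
/-- The index of the gap after `k` in the safe set. -/
noncomputable def hybridNext (m g k : ℕ) : ℕ :=
  if ZeckGE (g + 3) k then if Raisable m (g + 1) k then g + 2 else g + 1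
  else if ZeckGE (g + 2) k then g + 1 else g

theorem hybridNext_of_raisable {m g k : ℕ} (h : ZeckGE (g + 3) k) (hR : Raisable m (g + 1) k) :
    hybridNext m g k = g + 2 := by
  unfold hybridNext
  rw [if_pos h, if_pos hR]

theorem hybridNext_of_not_raisable {m g k : ℕ} (h : ZeckGE (g + 3) k)
    (hR : ¬ Raisable m (g + 1) k) : hybridNext m g k = g + 1 := by
  unfold hybridNext
  rw [if_pos h, if_neg hR]

theorem MinPart.hybridNext_succ {m g k u b : ℕ} (h : MinPart k u b) (hb : b = g + 2) :
    hybridNext m g k = g + 1 := by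
  unfold hybridNext
  rw [if_neg fun h' => by have := h.zeckGE_iff.1 h'; omega, if_pos (h.zeckGE_iff.2 (by omega))]

theorem MinPart.hybridNext_self {m g k u b : ℕ} (h : MinPart k u b) (hb : b = g + 1) :
    hybridNext m g k = g := by
  unfold hybridNext
  rw [if_neg fun h' => by have := h.zeckGE_iff.1 h'; omega,
    if_neg fun h' => by have := h.zeckGE_iff.1 h'; omega]

/-- The three kinds of numbers without Zeckendorf indices below `g + 1`. -/
theorem zeckGE_cases {g k : ℕ} (h : ZeckGE (g + 1) k) :
    ZeckGE (g + 3) k ∨ (∃ u, MinPart k u (g + 2)) ∨ ∃ u, MinPart k u (g + 1) := by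
  rcases Nat.eq_zero_or_pos k with rfl | hk
  · exact Or.inl (zeckGE_zero _)
  · obtain ⟨u, b, hb⟩ := exists_minPart hk
    have h1 := hb.zeckGE_iff.1 h
    by_cases h3 : g + 3 ≤ b
    · exact Or.inl (hb.zeckGE_iff.2 h3)
    · rcases (by omega : b = g + 2 ∨ b = g + 1) with rfl | rfl
      · exact Or.inr (Or.inl ⟨u, hb⟩)
      · exact Or.inr (Or.inr ⟨u, hb⟩)

/-- The only delicate case is `k` with all indices at least `g + 3`: the candidate `k + F_{g+1}` has
smallest index `g + 1`, hence is safe iff not raisable; if it fails, the next element is `k +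
F_{g+2}`. -/
theorem Follows.ps_eq_safeSet {W : ℕ → ℕ} {m g : ℕ} (hg : 1 ≤ g)
    (hW : Follows W (hybridNext m g)) : PS W = safeSet m g := by
  refine hW.ps_eq (zero_mem_safeSet m g) fun k hk => ?_
  have hk1 := zeckGE_of_mem_safeSet hk
  have hgap : ∀ i, i ≤ g + 1 → ZeckGE (i + 1) k → ∀ s, 0 < s → s < Nat.fib i →
      k + s ∉ safeSet m g := by
    intro i hi hki s h0 hs hks
    have h1 := ((zeckGE_add hki hs).1 (zeckGE_of_mem_safeSet hks)).2.fib_le h0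
    have h2 := Nat.fib_mono hi
    omega
  rcases zeckGE_cases hk1 with h3 | ⟨u, hu⟩ | ⟨u, hu⟩
  · have hmin : MinPart (k + Nat.fib (g + 1)) k (g + 1) := MinPart.of_zeckGE (by omega) h3
    by_cases hR : Raisable m (g + 1) k
    · rw [hybridNext_of_raisable h3 hR]
      refine ⟨Nat.fib_pos.2 (by omega), (ZeckGE.add_fib (by omega) h3).mem_safeSet,
        fun s h0 hs hks => ?_⟩
      rw [Nat.fib_add_two] at hs
      rcases lt_trichotomy s (Nat.fib (g + 1)) with h | h | h
      · exact hgap (g + 1) le_rfl (h3.anti (by omega)) s h0 h hks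
      · rw [h, hmin.mem_safeSet_iff, threshold_of_raisable hR] at hks
        omega
      · have h4 : ZeckGE (g + 1) (k + Nat.fib (g + 1)) := hmin.zeckGE_iff.2 le_rfl
        have h5 := zeckGE_of_mem_safeSet hks
        rw [show k + s = k + Nat.fib (g + 1) + (s - Nat.fib (g + 1)) by omega,
          zeckGE_add h4 (by omega)] at h5
        have := h5.2.fib_le (by omega)
        have := Nat.fib_mono (show g ≤ g + 1 by omega)
        omega
    · rw [hybridNext_of_not_raisable h3 hR]
      refine ⟨Nat.fib_pos.2 (by omega), ?_, hgap _ le_rfl (h3.anti (by omega))⟩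
      rw [hmin.mem_safeSet_iff, threshold_of_not_raisable hR]
  · rw [hu.hybridNext_succ rfl]
    refine ⟨Nat.fib_pos.2 (by omega), ?_, hgap _ le_rfl (hu.zeckGE_iff.2 le_rfl)⟩
    exact (hu.zeckGE_add_fib_pred.anti (by omega)).mem_safeSet
  · rw [hu.hybridNext_self rfl]
    refine ⟨Nat.fib_pos.2 (by omega), ?_, hgap _ (by omega) hk1⟩
    exact hu.zeckGE_add_fib_pred.mem_safeSet

/-! ### Bounds for the parameters -/

theorem fib_pIndex_le (m : ℕ) : Nat.fib (pIndex m) ≤ m :=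
  Nat.fib_greatestFib_le m

theorem lt_fib_pIndex_succ (m : ℕ) : m < Nat.fib (pIndex m + 1) :=
  Nat.lt_fib_greatestFib_add_one m

/-! ### Raisability in terms of `p(m)` -/

/-- Both bounds `m + F_g` and `m + F_{g+1}` lie in `[F_p, F_{p+2})`, so the top indices can differ
only through index `p + 1`. Outside that situation they agree and the parity flips. -/
theorem raisable_iff_not_raisable_of_not_special {m g k : ℕ} (hg : g + 1 ≤ pIndex m)
    (hk : ZeckGE (g + 3) k)
    (h : ¬ (m + Nat.fib g < Nat.fib (pIndex m + 1) ∧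
      Nat.fib (pIndex m + 1) ≤ m + Nat.fib (g + 1) ∧ ZeckGE (pIndex m + 2) k)) :
    Raisable m g k ↔ ¬ Raisable m (g + 1) k := by
  have hp := fib_pIndex_le m
  have hp' := lt_fib_pIndex_succ m
  have hfg := Nat.fib_mono hg
  have hgg := Nat.fib_mono (show g ≤ g + 1 by omega)
  have h1 : g + 1 ≤ topIndex m g k :=
    le_topIndex_iff.2 ⟨by omega, hk.anti (by omega)⟩
  have h2 : ∀ i, i ≤ topIndex m g k ↔ i ≤ topIndex m (g + 1) k := by
    intro i
    rw [le_topIndex_iff, le_topIndex_iff]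
    refine and_congr_left fun hi => ?_
    rcases lt_trichotomy i (pIndex m + 1) with hlt | rfl | hgt
    · have := Nat.fib_mono (show i ≤ pIndex m by omega)
      exact ⟨fun _ => by omega, fun _ => by omega⟩
    · constructor
      · omega
      · intro h3
        by_contra h4
        exact h ⟨by omega, h3, hi⟩
    · have := Nat.fib_mono (show pIndex m + 2 ≤ i by omega)
      rw [Nat.fib_add_two] at this
      omega
  have h3 : topIndex m (g + 1) k = topIndex m g k :=
    le_antisymm ((h2 _).2 le_rfl) ((h2 _).1 le_rfl)
  unfold Raisable
  rw [h3, show topIndex m g k - g = topIndex m g k - (g + 1) + 1 by omega, Nat.odd_add_one]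

/-- The top index moves from `p` to `p + 1` together with the step from `g` to `g + 1`, so the
difference is `p - g` both times. -/
theorem raisable_special {m g k : ℕ} (hg : g + 1 ≤ pIndex m)
    (h1 : m + Nat.fib g < Nat.fib (pIndex m + 1))
    (h2 : Nat.fib (pIndex m + 1) ≤ m + Nat.fib (g + 1)) (hk : ZeckGE (pIndex m + 2) k) :
    (Raisable m g k ↔ Odd (pIndex m - g)) ∧ (Raisable m (g + 1) k ↔ Odd (pIndex m - g)) := by
  have hp := fib_pIndex_le m
  have hp' := lt_fib_pIndex_succ m
  have hfg := Nat.fib_mono hg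
  have h3 : pIndex m ≤ topIndex m g k := le_topIndex_iff.2 ⟨by omega, hk.anti (by omega)⟩
  have h4 : ¬ pIndex m + 1 ≤ topIndex m g k := fun h => by
    have := (le_topIndex_iff.1 h).1
    omega
  have h5 : pIndex m + 1 ≤ topIndex m (g + 1) k := le_topIndex_iff.2 ⟨h2, hk⟩
  have h6 : ¬ pIndex m + 2 ≤ topIndex m (g + 1) k := fun h => by
    have := (le_topIndex_iff.1 h).1
    rw [Nat.fib_add_two] at this
    omega
  unfold Raisable
  rw [show topIndex m g k - g = pIndex m - g by omega,
    show topIndex m (g + 1) k - (g + 1) = pIndex m - g by omega]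
  exact ⟨Iff.rfl, Iff.rfl⟩

/-- The part `F_{p+1}` of `k` caps the top index at `p`. This decides the sums that lie in `PS(w_p)`
but violate the stronger index bound `p + 2`. -/
theorem raisable_iff_even {m g k : ℕ} (hg : g + 1 ≤ pIndex m) (hk : ZeckGE (pIndex m + 1) k)
    (hk' : ¬ ZeckGE (pIndex m + 2) k) : Raisable m (g + 1) k ↔ Even (pIndex m - g) := by
  have hp := fib_pIndex_le m
  have h3 : pIndex m ≤ topIndex m (g + 1) k := le_topIndex_iff.2 ⟨by omega, hk⟩
  have h4 : ¬ pIndex m + 1 ≤ topIndex m (g + 1) k := fun h => hk' (le_topIndex_iff.1 h).2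
  unfold Raisable
  rw [show topIndex m (g + 1) k - (g + 1) = pIndex m - (g + 1) by omega,
    show pIndex m - g = pIndex m - (g + 1) + 1 by omega, Nat.even_add_one, Nat.not_even_iff_odd]

theorem raisable_pIndex {m k : ℕ} (hm : 0 < m) (hk : ZeckGE (pIndex m + 2) k) :
    Raisable m (pIndex m) k := by
  have hp := fib_pIndex_le m
  have hp' := lt_fib_pIndex_succ m
  have hp2 : 2 ≤ pIndex m := two_le_greatestFib hm
  have h1 := fib_split (show 1 ≤ pIndex m by omega)
  have h2 := Nat.fib_mono (Nat.sub_le (pIndex m) 1)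
  have h5 : pIndex m + 1 ≤ topIndex m (pIndex m) k := le_topIndex_iff.2 ⟨by omega, hk⟩
  have h6 : ¬ pIndex m + 2 ≤ topIndex m (pIndex m) k := fun h => by
    have := (le_topIndex_iff.1 h).1
    rw [Nat.fib_add_two] at this
    omega
  unfold Raisable
  rw [show topIndex m (pIndex m) k - pIndex m = 1 by omega]
  exact odd_one

/-! ### The blocks of the hybrid words -/

/-- What is needed of the block that replaces the letter `i` after letters of sum `k`, if the new
word is to have the letters `hybridNext m h`. -/
structure GoodBlock (m h k i : ℕ) (l : List ℕ) : Prop where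
  ne_nil : l ≠ []
  sum_eq : listSum l = Nat.fib i
  follows : 1 ≤ h → ListFollows (hybridNext m h) k l
  fib_le_one : h = 0 → ∀ c ∈ l, Nat.fib c ≤ 1

theorem goodBlock_singleton {m h k i : ℕ} (hi : hybridNext m h k = i ∨ h = 0) (hi' : i ≤ h + 2) :
    GoodBlock m h k i [i] where
  ne_nil := by simp
  sum_eq := by simp
  follows h1 := by
    rcases hi with rfl | rfl
    · exact ⟨rfl, trivial⟩
    · omega
  fib_le_one h0 c hc := by
    obtain rfl := List.mem_singleton.1 hc
    exact (Nat.fib_mono (show c ≤ 2 by omega)).trans (by decide)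

theorem goodBlock_split_largest {m h k : ℕ} (hk : ZeckGE (h + 4) k)
    (hR : Raisable m (h + 1) k) : GoodBlock m h k (h + 3) [h + 2, h + 1] where
  ne_nil := by simp
  sum_eq := by
    rw [Nat.fib_add_two (n := h + 1)]
    simp only [listSum_cons, listSum_nil]
    ring
  follows _ := by
    have h1 := MinPart.of_zeckGE (b := h + 2) (by omega) hk
    exact ⟨(hybridNext_of_raisable (hk.anti (by omega)) hR).symm, (h1.hybridNext_succ rfl).symm,
      trivial⟩
  fib_le_one h0 c hc := by
    subst h0
    fin_cases hc <;> decide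

theorem goodBlock_split_second {m h k : ℕ} (hk : ZeckGE (h + 4) k)
    (hR : ¬ Raisable m (h + 1) k) : GoodBlock m h k (h + 2) [h + 1, h] where
  ne_nil := by simp
  sum_eq := by
    rw [Nat.fib_add_two]
    simp [add_comm]
  follows h1 := by
    have h2 := MinPart.of_zeckGE (b := h + 1) (by omega) (hk.anti (by omega))
    exact ⟨(hybridNext_of_not_raisable (hk.anti (by omega)) hR).symm,
      (h2.hybridNext_self rfl).symm, trivial⟩
  fib_le_one h0 c hc := by
    subst h0
    fin_cases hc <;> decide

theorem goodBlock_triple {m h k : ℕ} (hk : ZeckGE (h + 4) k)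
    (hR : ¬ Raisable m (h + 1) k) : GoodBlock m h k (h + 3) [h + 1, h, h + 1] where
  ne_nil := by simp
  sum_eq := by
    rw [Nat.fib_add_two (n := h + 1), Nat.fib_add_two (n := h)]
    simp only [listSum_cons, listSum_nil]
    ring
  follows h1 := by
    have h2 := MinPart.of_zeckGE (b := h + 1) (by omega) (hk.anti (by omega))
    have h3 := MinPart.of_zeckGE (b := h + 2) (by omega) hk
    refine ⟨(hybridNext_of_not_raisable (hk.anti (by omega)) hR).symm,
      (h2.hybridNext_self rfl).symm, ?_, trivial⟩
    rw [show k + Nat.fib (h + 1) + Nat.fib h = k + Nat.fib (h + 2) by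
      rw [Nat.fib_add_two]; ring]
    exact (h3.hybridNext_succ rfl).symm
  fib_le_one h0 c hc := by
    subst h0
    fin_cases hc <;> decide

theorem isSpecial_iff {m j h : ℕ} (hp : pIndex m = j + h + 2) :
    IsSpecial m j ↔ m + Nat.fib (h + 1) < Nat.fib (pIndex m + 1) ∧
      Nat.fib (pIndex m + 1) ≤ m + Nat.fib (h + 1 + 1) := by
  unfold IsSpecial
  rw [show pIndex m - (j + 1) = h + 1 by omega, show pIndex m - j = h + 1 + 1 by omega]
  omega

theorem mem_ps_sturmWord_pIndex {m k : ℕ} (hp : 1 ≤ pIndex m) :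
    k ∈ PS (sturmWord (pIndex m)) ↔ ZeckGE (pIndex m + 1) k := by
  rw [ps_sturmWord hp]
  rfl

/-- A letter `F_{h+3}` or `F_{h+2}` after a sum with indices at least `h + 4` encodes raisability at
`h + 2`; the new block must encode it at `h + 1`. A flip means (T3) or (T1), no flip means (T2). -/
theorem goodBlock_hybridBlock {m j h k : ℕ} (hp : pIndex m = j + h + 2)
    (hk : ZeckGE (h + 2) k) :
    GoodBlock m h k (hybridNext m (h + 1) k) (hybridBlock m j k (hybridNext m (h + 1) k)) := by
  have hpm := fib_pIndex_le m
  have hps := mem_ps_sturmWord_pIndex (m := m) (k := k) (by omega)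
  have hsp := isSpecial_iff hp
  have hpg : pIndex m - (h + 1) = j + 1 := by omega
  have hlarge : pIndex m - j + 1 = h + 3 := by omega
  have hsecond : pIndex m - j = h + 2 := by omega
  rcases zeckGE_cases hk with h3 | ⟨u, hu⟩ | ⟨u, hu⟩
  · by_cases hR : Raisable m (h + 1 + 1) k
    · rw [hybridNext_of_raisable h3 hR]
      unfold hybridBlock
      rw [if_pos (by omega)]
      split_ifs with hc
      · obtain ⟨hc1, hc2, hc3⟩ := hc
        -- Membership in `PS(w_p)` only yields index at least `p + 1`; the parity of `α` excludes
        -- equality.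
        have h4 : ZeckGE (pIndex m + 2) k := by
          by_contra h4
          have := (raisable_iff_even (by omega) (hps.1 hc3) h4).1 hR
          rw [hpg] at this
          exact Nat.not_even_iff_odd.2 hc2 this
        obtain ⟨h5, h6⟩ := hsp.1 hc1
        exact goodBlock_split_largest h3
          ((raisable_special (by omega) h5 h6 h4).1.2 (by rwa [hpg]))
      · refine goodBlock_triple h3 fun hR' => ?_
        refine (raisable_iff_not_raisable_of_not_special (by omega) h3 ?_).1 hR' hR
        rintro ⟨h5, h6, h7⟩
        have := (raisable_special (by omega) h5 h6 h7).2.1 hR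
        rw [hpg] at this
        exact hc ⟨hsp.2 ⟨h5, h6⟩, this, hps.2 (h7.anti (by omega))⟩
    · rw [hybridNext_of_not_raisable h3 hR]
      unfold hybridBlock
      rw [if_neg (by omega), if_pos (by omega)]
      split_ifs with hc
      · obtain ⟨hc1, hc2, hc3⟩ := hc
        have h4 : ZeckGE (pIndex m + 2) k := by
          by_contra h4
          refine hR ((raisable_iff_even (by omega) (hps.1 hc3) h4).2 ?_)
          rwa [hpg]
        obtain ⟨h5, h6⟩ := hsp.1 hc1
        refine goodBlock_split_second h3 fun hR' => hR ?_
        have h7 := raisable_special (by omega) h5 h6 h4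
        exact h7.2.2 (h7.1.1 hR')
      · refine goodBlock_singleton (Or.inl ?_) le_rfl
        refine hybridNext_of_raisable (h3.anti (by omega)) ?_
        refine (raisable_iff_not_raisable_of_not_special (by omega) h3 ?_).2 hR
        rintro ⟨h5, h6, h7⟩
        refine hc ⟨hsp.2 ⟨h5, h6⟩, ?_, hps.2 (h7.anti (by omega))⟩
        by_contra hodd
        refine hR ((raisable_special (by omega) h5 h6 h7).2.2 ?_)
        rw [hpg]
        exact Nat.not_even_iff_odd.1 hodd
  · rw [hu.hybridNext_succ rfl]
    unfold hybridBlock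
    rw [if_neg (by omega), if_pos (by omega), if_neg]
    · refine goodBlock_singleton ?_ le_rfl
      rcases Nat.eq_zero_or_pos h with rfl | hpos
      · exact Or.inr rfl
      · refine Or.inl (hybridNext_of_raisable (hu.zeckGE_iff.2 le_rfl) ?_)
        refine raisable_of_carry (by omega) ?_ (hu.zeckGE_iff.2 le_rfl) fun h' => ?_
        · exact (Nat.fib_mono (by omega)).trans hpm
        · have := hu.zeckGE_iff.1 h'
          omega
    -- The smallest index here is `h + 3`, so membership in `PS(w_p)` forces `j = 0`, contradicting
    -- the even `α`.
    · rintro ⟨-, hc2, hc3⟩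
      have h5 := hu.zeckGE_iff.1 (hps.1 hc3)
      obtain rfl : j = 0 := by omega
      simp at hc2
  · rw [hu.hybridNext_self rfl]
    unfold hybridBlock
    rw [if_neg (by omega), if_neg (by omega)]
    exact goodBlock_singleton (Or.inl (hu.hybridNext_succ rfl)) (by omega)

/-! ### The hybrid words -/

theorem follows_hybridWord_zero {m g : ℕ} (hp : pIndex m = g + 1) (hg : 1 ≤ g) :
    Follows (hybridWord m 0) (hybridNext m g) := by
  have hm : 0 < m := by
    refine Nat.pos_of_ne_zero fun h => ?_
    subst h
    have := fib_pIndex_le 0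
    rw [hp] at this
    exact absurd this (not_le.2 (Nat.fib_pos.2 (by omega)))
  have hp1 : 1 ≤ pIndex m := by omega
  intro i
  have h1 := follows_sturmWord hp1 i
  have h2 : partialSum (sturmWord (pIndex m)) i ∈ PS (sturmWord (pIndex m)) := ⟨i, rfl⟩
  rw [mem_ps_sturmWord_pIndex hp1, hp] at h2
  change sturmWord (pIndex m) i = hybridNext m g (partialSum (sturmWord (pIndex m)) i)
  rw [h1]
  unfold sturmNext
  split_ifs with h3
  · have h4 := raisable_pIndex hm h3
    rw [hp] at h3 h4 ⊢
    rw [hybridNext_of_raisable h3 h4]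
  · rw [hp] at h3 ⊢
    rcases zeckGE_cases (g := g) (h2.anti (by omega)) with h4 | ⟨u, hu⟩ | ⟨u, hu⟩
    · exact absurd h4 h3
    · rw [hu.hybridNext_succ rfl]
    · have := hu.zeckGE_iff.1 h2
      omega

theorem follows_hybridWord {m j g : ℕ} (hp : pIndex m = j + g + 1) (hg : 1 ≤ g) :
    Follows (hybridWord m j) (hybridNext m g) := by
  induction j generalizing g with
  | zero => exact follows_hybridWord_zero (by omega) hg
  | succ j ih =>
    have hW := ih (g := g + 1) (by omega) (by omega)
    have hgood : ∀ n, GoodBlock m g (partialSum (hybridWord m j) n) (hybridWord m j n)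
        (hybridBlock m j (partialSum (hybridWord m j) n) (hybridWord m j n)) := fun n => by
      have hmem : partialSum (hybridWord m j) n ∈ safeSet m (g + 1) := by
        rw [← hW.ps_eq_safeSet (by omega)]
        exact ⟨n, rfl⟩
      rw [hW n]
      exact goodBlock_hybridBlock (by omega) (zeckGE_of_mem_safeSet hmem)
    exact follows_concatWord (fun n => (hgood n).ne_nil) (fun n => (hgood n).sum_eq)
      fun n => (hgood n).follows hg

theorem safeSet_zero_right (m : ℕ) : safeSet m 0 = Set.univ :=
  Set.eq_univ_of_forall fun k => (zeckGE_two k).mem_safeSet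

theorem ps_hybridWord {m j g : ℕ} (hj : 1 ≤ j) (hp : pIndex m = j + g + 1) :
    PS (hybridWord m j) = safeSet m g := by
  -- At `g = 0` the letter `F_0 = 0` can occur, so the gap rule is unavailable. There every `k` is
  -- safe, and it suffices that letters are at most `1` with unbounded sums.
  rcases Nat.eq_zero_or_pos g with rfl | hg
  · obtain ⟨j, rfl⟩ := Nat.exists_eq_add_of_le' hj
    have hW := follows_hybridWord (m := m) (j := j) (g := 1) (by omega) le_rfl
    have hps := hW.ps_eq_safeSet le_rfl
    have hgood : ∀ n, GoodBlock m 0 (partialSum (hybridWord m j) n) (hybridWord m j n)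
        (hybridBlock m j (partialSum (hybridWord m j) n) (hybridWord m j n)) := fun n => by
      have hmem : partialSum (hybridWord m j) n ∈ safeSet m 1 := by
        rw [← hps]
        exact ⟨n, rfl⟩
      rw [hW n]
      exact goodBlock_hybridBlock (by omega) (zeckGE_of_mem_safeSet hmem)
    have hne := fun n => (hgood n).ne_nil
    rw [safeSet_zero_right]
    refine ps_eq_univ (fun i => ?_) fun k => ?_
    · obtain ⟨n, hn⟩ := concatWord_mem hne i
      exact (hgood n).fib_le_one rfl _ hn
    -- Sums of the previous word survive in the new one; the shift by `5` gives `k + 5 ≤ F_{k+5}`.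
    · have hmem : Nat.fib (k + 5) ∈ safeSet m 1 :=
        ZeckGE.mem_safeSet ((zeckGE_fib (by omega)).2 (by omega))
      rw [← hps] at hmem
      obtain ⟨n, hn⟩ := hmem
      obtain ⟨t, ht⟩ := partialSum_concatWord hne (fun n => (hgood n).sum_eq) n
      refine ⟨t, ?_⟩
      change k ≤ partialSum (concatWord _) t
      rw [ht, ← hn]
      have := Nat.le_fib_self (show 5 ≤ k + 5 by omega)
      omega
  · exact (follows_hybridWord hp hg).ps_eq_safeSet hg

/-! ### The sets `σ_m(α)` -/

theorem safeSet_eq_of_pIndex_lt {m g : ℕ} (hg : pIndex m + 1 ≤ g) :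
    safeSet m g = {k | ZeckGE (g + 1) k} := by
  ext k
  refine ⟨zeckGE_of_mem_safeSet, fun hk u b hb => ?_⟩
  have h1 := hb.zeckGE_iff.1 hk
  have h2 : ¬ b + 1 ≤ topIndex m b u := fun h => by
    have h3 := (le_topIndex_iff.1 h).1
    have h4 := lt_fib_pIndex_succ m
    have h5 := Nat.fib_mono (show pIndex m + 1 ≤ b - 1 by omega)
    rw [fib_split (by omega)] at h3
    omega
  have h3 : ¬ Raisable m b u := by
    unfold Raisable
    rw [show topIndex m b u - b = 0 by omega]
    simp
  rw [threshold_of_not_raisable h3]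
  exact h1

/-- Since `F_{p+2} ≤ m + F_{p+1} < F_{p+3}`, the top index is `p + 2`. This removes smallest index
`p + 1` at `g = p` and accounts for the shifted word `w_{p+1}` at `α = 1`. -/
theorem threshold_pIndex_succ {m k u : ℕ} (h : MinPart k u (pIndex m + 1)) :
    threshold m (pIndex m + 1) u = pIndex m := by
  have h1 := fib_pIndex_le m
  have h2 := lt_fib_pIndex_succ m
  have h3 : pIndex m + 2 ≤ topIndex m (pIndex m + 1) u := by
    rw [le_topIndex_iff, Nat.fib_add_two]
    exact ⟨by omega, h.rest⟩
  have h4 : ¬ pIndex m + 3 ≤ topIndex m (pIndex m + 1) u := fun h => by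
    have h5 := (le_topIndex_iff.1 h).1
    rw [Nat.fib_add_two (n := pIndex m + 1), Nat.fib_add_two] at h5
    omega
  refine threshold_of_raisable ?_
  unfold Raisable
  rw [show topIndex m (pIndex m + 1) u - (pIndex m + 1) = 1 by omega]
  exact odd_one

theorem safeSet_pIndex (m : ℕ) : safeSet m (pIndex m) = {k | ZeckGE (pIndex m + 2) k} := by
  ext k
  refine ⟨fun hk => ?_, ZeckGE.mem_safeSet⟩
  refine zeckGE_of_minPart fun u b hb => ?_
  have h1 := hk u b hb
  have h2 := threshold_le m b u
  by_contra h3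
  obtain rfl : b = pIndex m + 1 := by omega
  rw [threshold_pIndex_succ hb] at h1
  omega

theorem safeSet_pIndex_pred {m g : ℕ} (hp : pIndex m = g + 1) :
    safeSet m g = {k | ZeckGE (pIndex m + 1) k} := by
  rw [hp]
  ext k
  refine ⟨fun hk => ?_, ZeckGE.mem_safeSet⟩
  refine zeckGE_of_minPart fun u b hb => ?_
  have h1 := hk u b hb
  have h2 := threshold_le m b u
  by_contra h3
  obtain rfl : b = pIndex m := by omega
  have hm : 0 < m := by
    refine Nat.pos_of_ne_zero fun h => ?_
    subst h
    have := fib_pIndex_le 0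
    rw [hp] at this
    exact absurd this (not_le.2 (Nat.fib_pos.2 (by omega)))
  by_cases hR : Raisable m (pIndex m) u
  · rw [threshold_of_raisable hR] at h1
    omega
  · exact hR (raisable_pIndex hm hb.rest)

theorem sigma_eq_safeSet (m r : ℕ) :
    sigma m (alphaIndex r (pIndex m)) = safeSet m (Nat.greatestFib r) := by
  unfold sigma alphaIndex
  generalize Nat.greatestFib r = g
  split_ifs with h1 h2
  · exact ps_hybridWord (by omega) (by omega)
  · rcases (by omega : g = pIndex m ∨ g + 1 = pIndex m) with rfl | h
    · rw [show ((pIndex m : ℤ) + ((pIndex m : ℤ) + 1 - (pIndex m : ℤ))).toNat = pIndex m + 1 by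
        omega, ps_sturmWord (by omega), safeSet_pIndex]
    · rw [show ((pIndex m : ℤ) + ((g : ℤ) + 1 - (pIndex m : ℤ))).toNat = pIndex m by omega,
        ps_sturmWord (by omega), safeSet_pIndex_pred h.symm]
  · rw [show ((pIndex m : ℤ) + ((g : ℤ) + 1 - (pIndex m : ℤ)) - 1).toNat = g by omega,
      ps_sturmWord (by omega), safeSet_eq_of_pIndex_lt (by omega)]

end FibNim

theorem mainTheorem2 (m k r : ℕ) :
    FibNim.IsP ⟨m, m + k, r⟩ ↔ k ∈ FibNim.sigma m (FibNim.alphaIndex r (FibNim.pIndex m)) := by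
  rw [FibNim.isP_iff_safe, FibNim.safe_iff_mem_safeSet, FibNim.sigma_eq_safeSet]
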